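/- **Setting.** A probability measure $\pi$ on $\mathbb R$ is *1-log-smooth* if it has a density proportional to $\exp(-V)$ for some $C^2$ function $V:\mathbb R\to\mathbb R$ whose derivative $V'$ is $1$-Lipschitz. For probability measures $\mu,\pi$ on $\mathbb R$, the relative Fisher information is $\mathsf{FI}(\mu\,\|\,\pi)=\mathbb E_\mu\bigl[\bigl|(\ln\tfrac{d\mu}{d\pi})'\bigr|^2\bigr]$ if $\mu\ll\pi$ and $\tfrac{d\mu}{d\pi}$ has a locally absolutely continuous version, and $+\infty$ otherwise. Let $M_0\ge 0$ and $\varepsilon>0$. In the *stronger warm-start oracle model*, a randomized adaptive algorithm has access to an unknown 1-log-smooth target $\pi\propto\exp(-V)$ on $\mathbb R$ in two ways. First, it is given, at no cost, a probability measure $\mu_0$, together with independent samples from it, such that $$\max\Bigl\{\sup\ln\frac{\mu_0}{\pi},\ \sup\ln\frac{\pi}{\mu_0}\Bigr\}\le M_0 ,$$ where the suprema are essential suprema. Second, it may query a local oracle at points $x\in\mathbb R$ of its choice; the oracle returns $(V(x),V'(x))$, where the potential $V$ is known only up to an additive constant. Let $\mathscr C_\infty(1,M_0,\varepsilon)\in\mathbb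 N\cup\{\infty\}$ be the least $N$ for which some algorithm making at most $N$ queries to the local oracle outputs, for every 1-log-smooth $\pi$ on $\mathbb R$ and every such $\mu_0$, a sample from a measure $\mu$ (which may depend on $\pi$ and $\mu_0$) with $\sqrt{\mathsf{FI}(\mu\,\|\,\pi)}\le\varepsilon$. **Corollary.** There exist universal constants $c>1$ and $k>0$ such that for all $0<\varepsilon\le 1/c$, $$\mathscr C_\infty\bigl(1,\;c\log(1/\varepsilon),\;\varepsilon\bigr)\ \ge\ \frac{k}{\varepsilon\sqrt{\log(1/\varepsilon)}} .$$ -/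

import Mathlib

open MeasureTheory
open scoped ENNReal

/-- `V` is the potential of a `β`-log-smooth distribution on `ℝ`: it is twice continuously
differentiable, its derivative is `β`-Lipschitz, and `exp (-V)` can be normalised. -/
structure IsLogSmoothPotential (β : ℝ) (V : ℝ → ℝ) : Prop where
  contDiff : ContDiff ℝ 2 V
  lipschitz : ∀ x y : ℝ, |deriv V x - deriv V y| ≤ β * |x - y|
  integrable : Integrable (fun x => Real.exp (-V x)) volume

/-- The probability measure `π ∝ exp (-V)`, of density `exp (-V x) / ∫ exp (-V)`. -/
noncomputable def gibbs (V : ℝ → ℝ) : Measure ℝ :=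
  (volume : Measure ℝ).tilted (fun x => -V x)

/-- `f` is locally absolutely continuous with (weak) derivative `g`. -/
def HasLocalDensityDeriv (f g : ℝ → ℝ) : Prop :=
  LocallyIntegrable g volume ∧ ∀ a b : ℝ, ∫ x in a..b, g x = f b - f a

/-- The relative Fisher information `FI(μ ‖ π) = E_μ [ ((ln (dμ/dπ))')² ]`. Here `f` is the locally
absolutely continuous version of `dμ/dπ` and `g` its derivative, so that `(ln f)' = g / f` holds
`μ`-almost everywhere. The value is `∞` if there is no such version; if there is one, it is
determined, and `g` is determined almost everywhere, so that all terms of the infimum agree. -/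
noncomputable def fisherInfo (μ π : Measure ℝ) : ℝ≥0∞ :=
  ⨅ (f : ℝ → ℝ) (g : ℝ → ℝ)
    (_ : (∀ x, 0 ≤ f x) ∧ HasLocalDensityDeriv f g ∧
      μ = π.withDensity (fun x => ENNReal.ofReal (f x))),
    ∫⁻ x, ENNReal.ofReal ((g x / f x) ^ 2) ∂μ

/-- The condition `max {sup ln (μ₀/π), sup ln (π/μ₀)} ≤ M₀` on an initial distribution `μ₀`.
The suprema are essential suprema, since densities are only defined almost everywhere. -/
def IsWarmStart (M₀ : ℝ) (μ₀ π : Measure ℝ) : Prop :=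
  μ₀ ≪ π ∧ π ≪ μ₀ ∧ (∀ᵐ x ∂π, llr μ₀ π x ≤ M₀) ∧ (∀ᵐ x ∂π, llr π μ₀ x ≤ M₀)

/-- A randomised adaptive algorithm on `ℝ` that makes `N` queries to the local oracle (one that
stops early is padded by idle queries). It is given the initial distribution `μ₀`, as a measure, an
infinite sequence of samples from `μ₀`, and an internal random seed. Its `n`-th query point
(counted from `0`) is a function of these and of the `n` earlier triples
`(query point, value, derivative)`; its output is a function of these and of all `N` triples. -/
structure QueryAlgorithm (N : ℕ) where
  Seed : Type
  [instSeed : MeasurableSpace Seed]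
  seedLaw : Measure Seed
  [instProb : IsProbabilityMeasure seedLaw]
  query : Measure ℝ → (n : ℕ) → Seed × (ℕ → ℝ) × (Fin n → ℝ × ℝ × ℝ) → ℝ
  measurable_query : ∀ μ₀ n, Measurable (query μ₀ n)
  output : Measure ℝ → Seed × (ℕ → ℝ) × (Fin N → ℝ × ℝ × ℝ) → ℝ
  measurable_output : ∀ μ₀, Measurable (output μ₀)

namespace QueryAlgorithm

attribute [instance] QueryAlgorithm.instSeed QueryAlgorithm.instProb

/-- The first `n` triples `(x, V x, V' x)` seen when the local oracle answers for the potential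
`V`, given the seed `s` and the samples `z` from `μ₀`. -/
noncomputable def transcript {N : ℕ} (A : QueryAlgorithm N) (μ₀ : Measure ℝ) (V : ℝ → ℝ) (s : A.Seed) (z : ℕ → ℝ) :
    (n : ℕ) → Fin n → ℝ × ℝ × ℝ
  | 0 => Fin.elim0
  | n + 1 =>
    Fin.snoc (α := fun _ => ℝ × ℝ × ℝ) (A.transcript μ₀ V s z n)
      (A.query μ₀ n (s, z, A.transcript μ₀ V s z n),
        V (A.query μ₀ n (s, z, A.transcript μ₀ V s z n)),
        deriv V (A.query μ₀ n (s, z, A.transcript μ₀ V s z n)))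

/-- The law of the output, for a random seed and independent samples from `μ₀`. -/
noncomputable def outputLaw {N : ℕ} (A : QueryAlgorithm N) (μ₀ : Measure ℝ)
    [IsProbabilityMeasure μ₀] (V : ℝ → ℝ) : Measure ℝ :=
  (A.seedLaw.prod (Measure.infinitePi (fun _ : ℕ => μ₀))).map
    (fun p => A.output μ₀ (p.1, p.2, A.transcript μ₀ V p.1 p.2 N))

/-- The algorithm outputs a sample from some `μ` with `√FI(μ ‖ π) ≤ ε`, for every `1`-log-smooth
target `π` on `ℝ` and every initial distribution `μ₀` that is valid for `π`. The oracle only knows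
the potential up to a constant: every `V` with `π ∝ exp (-V)` is allowed. -/
def Achieves {N : ℕ} (A : QueryAlgorithm N) (M₀ ε : ℝ) : Prop :=
  ∀ V : ℝ → ℝ, IsLogSmoothPotential 1 V →
    ∀ (μ₀ : Measure ℝ) [IsProbabilityMeasure μ₀], IsWarmStart M₀ μ₀ (gibbs V) →
      fisherInfo (A.outputLaw μ₀ V) (gibbs V) ^ (1 / 2 : ℝ) ≤ ENNReal.ofReal ε

end QueryAlgorithm

/-- The query complexity in the stronger warm-start model on `ℝ`: the least number of queries with
which some algorithm achieves accuracy `ε` (`∞` if there is none). -/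
noncomputable def warmStartComplexity (M₀ ε : ℝ) : ℕ∞ :=
  ⨅ (N : ℕ) (_ : ∃ A : QueryAlgorithm N, A.Achieves M₀ ε), (N : ℕ∞)

/-! A needle-in-a-haystack argument. Take a Gaussian of scale `R ≈ 1/ε` and add to its log-density a
bump of width `w` around an unknown point `a`. Bounded curvature permits a height of order `w²`, so
`w ≈ √(log (1/ε))` gives height `log (1/ε)`, enough for the unit interval around `a` to hold a fixed
share of the target's mass although the Gaussian is `1/ε` wide. About `R / w ≈ 1 / (ε √(log (1/ε)))`
such bumps have disjoint supports.

The Gaussian is a valid `μ₀` for all these targets at once (`isWarmStart_holePotential`), so neither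
`μ₀` nor its samples reveal `a`. A query off the bump returns the Gaussian answer. Hence `N` queries
and the output can meet only `N + 1` bumps, and for some `a` the output falls near `a` with
probability at most `(N + 1) / n`, where `n` is the number of bumps
(`QueryAlgorithm.exists_outputLaw_le`).

Small Fisher information forbids this. Starting near `a` and moving outwards, the target has tails
of mass at most `O(R)` times the density, so an `L¹` Poincaré inequality holds with constant `O(R)`
(`lintegral_le_of_tail_bound`). With `R ε` small, the output must give the interval around `a` at
least half its target mass (`gibbs_holePotential_le`). Comparing the two bounds gives `n = O(N +
1)`. -/

/-! ### Fisher information and an `L¹` Poincaré inequality -/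

theorem HasLocalDensityDeriv.continuous {f g : ℝ → ℝ} (h : HasLocalDensityDeriv f g) :
    Continuous f := by
  have hi : ∀ a b : ℝ, IntervalIntegrable g volume a b := fun a b =>
    (h.1.integrableOn_isCompact isCompact_uIcc).intervalIntegrable
  have hf : f = fun x => f 0 + ∫ t in (0 : ℝ)..x, g t := by
    funext x
    rw [h.2 0 x]; ring
  rw [hf]
  exact continuous_const.add (intervalIntegral.continuous_primitive hi 0)

/-- At almost every zero of a nonnegative locally absolutely continuous function, its derivative
vanishes. -/
theorem HasLocalDensityDeriv.ae_eq_zero {f g : ℝ → ℝ} (h : HasLocalDensityDeriv f g)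
    (hf : ∀ x, 0 ≤ f x) : ∀ᵐ x, f x = 0 → g x = 0 := by
  filter_upwards [LocallyIntegrable.ae_hasDerivAt_integral h.1] with x hx hfx
  have h1 : HasDerivAt f (g x) x := by
    have h2 := (hx 0).const_add (f 0)
    have hfe : f = fun x => f 0 + ∫ t in (0 : ℝ)..x, g t := by
      funext x
      rw [h.2 0 x]; ring
    rw [hfe]
    exact h2
  have hmin : IsLocalMin f x := Filter.Eventually.of_forall fun y => by rw [hfx]; exact hf y
  exact hmin.hasDerivAt_eq_zero h1

/-- A one-dimensional `L¹` Poincaré inequality for a density `p` whose tails on both sides of `x₀`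
are controlled by `p` itself. -/
theorem lintegral_le_of_tail_bound {p : ℝ → ℝ≥0∞} (hp : Measurable p) {f g : ℝ → ℝ}
    (hfg : HasLocalDensityDeriv f g) {K : ℝ≥0∞} {x₀ : ℝ}
    (hr : ∀ y, x₀ ≤ y → ∫⁻ x in Set.Ici y, p x ≤ K * p y)
    (hl : ∀ y, y ≤ x₀ → ∫⁻ x in Set.Iic y, p x ≤ K * p y) :
    ∫⁻ x, p x * ENNReal.ofReal (f x) ≤
      ENNReal.ofReal (f x₀) * (∫⁻ x, p x) + K * ∫⁻ y, p y * ‖g y‖ₑ := by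
  have hpt : ∀ x, ENNReal.ofReal (f x) ≤
      ENNReal.ofReal (f x₀) + ∫⁻ y in Set.uIoc x₀ x, ‖g y‖ₑ := by
    intro x
    have h1 : f x = f x₀ + ∫ t in x₀..x, g t := by rw [hfg.2]; ring
    have h2 : ENNReal.ofReal (∫ t in x₀..x, g t) ≤ ∫⁻ y in Set.uIoc x₀ x, ‖g y‖ₑ := by
      calc ENNReal.ofReal (∫ t in x₀..x, g t) ≤ ‖∫ t in x₀..x, g t‖ₑ := Real.ofReal_le_enorm _
        _ = ‖∫ t in Set.uIoc x₀ x, g t‖ₑ := by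
            rw [← ofReal_norm, ← ofReal_norm,
              intervalIntegral.norm_intervalIntegral_eq]
        _ ≤ _ := enorm_integral_le_lintegral_enorm _
    rw [h1]
    exact ENNReal.ofReal_add_le.trans (by gcongr)
  have hS : MeasurableSet {q : ℝ × ℝ | q.2 ∈ Set.uIoc x₀ q.1} := by
    have : {q : ℝ × ℝ | q.2 ∈ Set.uIoc x₀ q.1} =
        {q | min x₀ q.1 < q.2} ∩ {q | q.2 ≤ max x₀ q.1} := rfl
    rw [this]
    exact (measurableSet_lt (by fun_prop) (by fun_prop)).inter
      (measurableSet_le (by fun_prop) (by fun_prop))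
  have hgm : AEMeasurable (fun y => ‖g y‖ₑ) volume := hfg.1.aestronglyMeasurable.enorm
  -- Tonelli: for fixed `y`, the points `x` with `y` between `x₀` and `x` lie in the tail beyond
  -- `y`, whose mass is at most `K * p y`.
  have hsw : ∫⁻ x, p x * ∫⁻ y in Set.uIoc x₀ x, ‖g y‖ₑ ≤ K * ∫⁻ y, p y * ‖g y‖ₑ := by
    have e1 : ∀ x, p x * ∫⁻ y in Set.uIoc x₀ x, ‖g y‖ₑ =
        ∫⁻ y, p x * ({q : ℝ × ℝ | q.2 ∈ Set.uIoc x₀ q.1}.indicator 1 (x, y) * ‖g y‖ₑ) := by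
      intro x
      rw [lintegral_const_mul'' _ (by
        refine AEMeasurable.mul ?_ hgm
        exact ((measurable_one.indicator hS).comp measurable_prodMk_left).aemeasurable),
        ← lintegral_indicator measurableSet_uIoc]
      congr 1
      refine lintegral_congr fun y => ?_
      by_cases hy : y ∈ Set.uIoc x₀ x <;> simp [Set.indicator, hy]
    simp_rw [e1]
    rw [lintegral_lintegral_swap,
      ← lintegral_const_mul'' (f := fun y => p y * ‖g y‖ₑ) K (hp.aemeasurable.mul hgm)]
    · refine lintegral_mono fun y => ?_
      have e2 : ∀ x, p x * ({q : ℝ × ℝ | q.2 ∈ Set.uIoc x₀ q.1}.indicator 1 (x, y) * ‖g y‖ₑ) =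
          {x | y ∈ Set.uIoc x₀ x}.indicator p x * ‖g y‖ₑ := by
        intro x
        by_cases hy : y ∈ Set.uIoc x₀ x <;> simp [Set.indicator, hy]
      have hT : MeasurableSet {x | y ∈ Set.uIoc x₀ x} :=
        (measurable_prodMk_right (y := y)) hS
      simp_rw [e2]
      rw [lintegral_mul_const _ (hp.indicator hT), lintegral_indicator hT, ← mul_assoc]
      gcongr
      rcases lt_or_ge x₀ y with h | h
      · refine le_trans (lintegral_mono_set ?_) (hr y h.le)
        intro x hx
        simp only [Set.mem_ofPred_eq, Set.mem_uIoc] at hx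
        rcases hx with hx | hx
        · exact hx.2
        · exact absurd hx.2 (not_le.2 h)
      · refine le_trans (lintegral_mono_set ?_) (hl y h)
        intro x hx
        simp only [Set.mem_ofPred_eq, Set.mem_uIoc] at hx
        rcases hx with hx | hx
        · exact absurd hx.1 (not_lt.2 h)
        · exact hx.1.le
    · refine AEMeasurable.mul (hp.comp measurable_fst).aemeasurable (AEMeasurable.mul ?_ ?_)
      · exact (measurable_one.indicator hS).aemeasurable
      · exact hgm.comp_quasiMeasurePreserving Measure.quasiMeasurePreserving_snd
  calc ∫⁻ x, p x * ENNReal.ofReal (f x)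
      ≤ ∫⁻ x, (ENNReal.ofReal (f x₀) * p x + p x * ∫⁻ y in Set.uIoc x₀ x, ‖g y‖ₑ) := by
        refine lintegral_mono fun x => ?_
        calc p x * ENNReal.ofReal (f x)
            ≤ p x * (ENNReal.ofReal (f x₀) + ∫⁻ y in Set.uIoc x₀ x, ‖g y‖ₑ) := by
              gcongr; exact hpt x
          _ = _ := by rw [mul_add, mul_comm]
    _ = ENNReal.ofReal (f x₀) * (∫⁻ x, p x) + ∫⁻ x, p x * ∫⁻ y in Set.uIoc x₀ x, ‖g y‖ₑ := by
        rw [lintegral_add_left (hp.const_mul _), lintegral_const_mul _ hp]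
    _ ≤ _ := by gcongr

/-- Some `x₀` in the interval has `f x₀` at most the average `μ/π` of the interval. The Poincaré
inequality from `x₀` bounds the total mass `1` of `f` by `f x₀` plus `K` times `E_μ |g / f|`, which
the Fisher information controls. As `x₀` is not explicit, both tail bounds are needed from anywhere
in the interval. -/
theorem measure_le_of_fisherInfo_le {p : ℝ → ℝ≥0∞} (hp : Measurable p)
    {μ : Measure ℝ} [IsProbabilityMeasure μ] [IsProbabilityMeasure (volume.withDensity p)]
    {ε : ℝ} (hε : 0 < ε)
    (hFI : fisherInfo μ (volume.withDensity p) ^ (1 / 2 : ℝ) ≤ ENNReal.ofReal ε)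
    {a b : ℝ} {K : ℝ≥0∞}
    (hr : ∀ y, a ≤ y → ∫⁻ x in Set.Ici y, p x ≤ K * p y)
    (hl : ∀ y, y ≤ b → ∫⁻ x in Set.Iic y, p x ≤ K * p y) :
    volume.withDensity p (Set.Icc a b) ≤
      μ (Set.Icc a b) + volume.withDensity p (Set.Icc a b) * (K * ENNReal.ofReal (2 * ε)) := by
  set π := volume.withDensity p with hπ
  rcases eq_or_ne (π (Set.Icc a b)) 0 with h0 | h0
  · rw [h0]; exact zero_le
  -- Doubling `ε` makes the bound strict, so that some pair `f`, `g` in the infimum satisfies it.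
  have hlt : fisherInfo μ π < ENNReal.ofReal (4 * ε ^ 2) := by
    have h1 : fisherInfo μ π ≤ ENNReal.ofReal (ε ^ 2) := by
      have := ENNReal.rpow_le_rpow hFI (z := 2) (by norm_num)
      rw [← ENNReal.rpow_mul] at this
      norm_num at this
      rwa [← ENNReal.ofReal_pow hε.le] at this
    refine h1.trans_lt ((ENNReal.ofReal_lt_ofReal_iff (by positivity)).2 ?_)
    nlinarith [sq_pos_of_pos hε]
  unfold fisherInfo at hlt
  simp only [iInf_lt_iff] at hlt
  obtain ⟨f, g, ⟨hf, hfg, hμ⟩, hI⟩ := hlt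
  have hfm : Measurable fun x => ENNReal.ofReal (f x) := hfg.continuous.measurable.ennreal_ofReal
  have hgm : AEMeasurable (fun y => ‖g y‖ₑ) volume := hfg.1.aestronglyMeasurable.enorm
  obtain ⟨x₀, hx₀, hx⟩ : ∃ x₀ ∈ Set.Icc a b,
      ENNReal.ofReal (f x₀) * π (Set.Icc a b) ≤ μ (Set.Icc a b) := by
    have hμB : μ (Set.Icc a b) = ∫⁻ x in Set.Icc a b, ENNReal.ofReal (f x) ∂π := by
      rw [hμ, withDensity_apply _ measurableSet_Icc]
    obtain ⟨x, hx, h⟩ := exists_le_setLAverage (f := fun x => ENNReal.ofReal (f x)) h0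
      (measure_ne_top _ _) hfm.aemeasurable
    refine ⟨x, hx, ?_⟩
    rw [setLAverage_eq, ← hμB] at h
    exact (ENNReal.le_div_iff_mul_le (Or.inl h0) (Or.inl (measure_ne_top _ _))).1 h
  have hgint : ∫⁻ y, p y * ‖g y‖ₑ ≤ ENNReal.ofReal (2 * ε) := by
    have h1 : ∫⁻ y, p y * ‖g y‖ₑ = ∫⁻ y, ‖g y‖ₑ ∂π := by
      rw [hπ, lintegral_withDensity_eq_lintegral_mul₀ hp.aemeasurable hgm]; rfl
    have hac : π ≪ volume := withDensity_absolutelyContinuous _ _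
    have hzero := hac.ae_le (hfg.ae_eq_zero hf)
    -- The inequality `t ≤ ε + t ^ 2 / (4 * ε)` replaces Cauchy–Schwarz. Where `f` vanishes so does
    -- `g`, almost everywhere, so the value of `g / 0` is harmless.
    have hpt : ∀ᵐ y ∂π, ‖g y‖ₑ ≤ ENNReal.ofReal (f y) *
        (ENNReal.ofReal ε + ENNReal.ofReal (1 / (4 * ε)) * ENNReal.ofReal ((g y / f y) ^ 2)) := by
      filter_upwards [hzero] with y hy
      rcases eq_or_lt_of_le (hf y) with h | h
      · simp [hy h.symm]
      · rw [← ENNReal.ofReal_mul (by positivity), ← ENNReal.ofReal_add hε.le (by positivity),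
          ← ENNReal.ofReal_mul h.le, ← ofReal_norm]
        refine ENNReal.ofReal_le_ofReal ?_
        have e : ‖g y‖ = f y * |g y / f y| := by
          rw [abs_div, abs_of_pos h, Real.norm_eq_abs]; field_simp
        rw [e]
        gcongr
        set t := |g y / f y| with ht
        rw [← sq_abs (g y / f y), ← ht]
        have e2 : ε + 1 / (4 * ε) * t ^ 2 - t = (t - 2 * ε) ^ 2 / (4 * ε) := by
          field_simp; ring
        have : 0 ≤ (t - 2 * ε) ^ 2 / (4 * ε) := by positivity
        linarith
    have hgfm : AEMeasurable (fun y => ENNReal.ofReal ((g y / f y) ^ 2)) volume :=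
      ((hfg.1.aestronglyMeasurable.aemeasurable.div
        hfg.continuous.measurable.aemeasurable).pow_const 2).ennreal_ofReal
    have hgfπ := hgfm.mono_ac hac
    have hμac : μ ≪ π := by rw [hμ]; exact withDensity_absolutelyContinuous _ _
    calc ∫⁻ y, p y * ‖g y‖ₑ = ∫⁻ y, ‖g y‖ₑ ∂π := h1
      _ ≤ _ := lintegral_mono_ae hpt
      _ = ∫⁻ y, (ENNReal.ofReal ε +
            ENNReal.ofReal (1 / (4 * ε)) * ENNReal.ofReal ((g y / f y) ^ 2)) ∂μ := by
          rw [hμ, lintegral_withDensity_eq_lintegral_mul₀ hfm.aemeasurable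
            ((hgfπ.const_mul _).const_add _)]
          rfl
      _ = ENNReal.ofReal ε +
            ENNReal.ofReal (1 / (4 * ε)) * ∫⁻ y, ENNReal.ofReal ((g y / f y) ^ 2) ∂μ := by
          rw [lintegral_add_left measurable_const,
            lintegral_const_mul'' _ (hgfπ.mono_ac hμac)]
          simp
      _ ≤ ENNReal.ofReal ε + ENNReal.ofReal (1 / (4 * ε)) * ENNReal.ofReal (4 * ε ^ 2) := by
          gcongr
      _ = ENNReal.ofReal (2 * ε) := by
          rw [← ENNReal.ofReal_mul (by positivity), ← ENNReal.ofReal_add hε.le (by positivity)]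
          congr 1
          field_simp; ring
  have hmain := lintegral_le_of_tail_bound hp hfg (x₀ := x₀) (K := K)
    (fun y hy => hr y (hx₀.1.trans hy)) (fun y hy => hl y (hy.trans hx₀.2))
  have hone : ∫⁻ x, p x * ENNReal.ofReal (f x) = 1 := by
    have : μ Set.univ = 1 := measure_univ
    rw [hμ, withDensity_apply _ MeasurableSet.univ, Measure.restrict_univ, hπ,
      lintegral_withDensity_eq_lintegral_mul₀ hp.aemeasurable hfm.aemeasurable] at this
    exact this
  have hpone : ∫⁻ x, p x = 1 := by
    have : π Set.univ = 1 := measure_univ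
    rwa [hπ, withDensity_apply _ MeasurableSet.univ, Measure.restrict_univ] at this
  rw [hone, hpone, mul_one] at hmain
  calc π (Set.Icc a b) = π (Set.Icc a b) * 1 := (mul_one _).symm
    _ ≤ π (Set.Icc a b) * (ENNReal.ofReal (f x₀) + K * ENNReal.ofReal (2 * ε)) := by
        gcongr
        exact hmain.trans (by gcongr)
    _ = ENNReal.ofReal (f x₀) * π (Set.Icc a b) +
        π (Set.Icc a b) * (K * ENNReal.ofReal (2 * ε)) := by
        rw [mul_add, mul_comm (π _)]
    _ ≤ _ := by gcongr

/-! ### A `C²` bump of bounded curvature -/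

theorem hasDerivAt_max_zero_pow (n : ℕ) (x : ℝ) :
    HasDerivAt (fun v : ℝ => max 0 v ^ (n + 2)) ((n + 2) * max 0 x ^ (n + 1)) x := by
  have hneg : ∀ v ∈ Set.Iic (0 : ℝ), max 0 v ^ (n + 2) = 0 := fun v hv => by
    simp [max_eq_left (Set.mem_Iic.1 hv)]
  have hpos : ∀ v ∈ Set.Ici (0 : ℝ), max 0 v ^ (n + 2) = v ^ (n + 2) := fun v hv => by
    rw [max_eq_right (Set.mem_Ici.1 hv)]
  have hpow : HasDerivAt (fun v : ℝ => v ^ (n + 2)) ((n + 2) * x ^ (n + 1)) x := by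
    simpa using hasDerivAt_pow (n + 2) x
  rcases lt_trichotomy x 0 with h | h | h
  · rw [max_eq_left h.le]
    simp only [ne_eq, Nat.add_eq_zero_iff, one_ne_zero, and_false, not_false_eq_true, zero_pow,
      mul_zero]
    refine (hasDerivAt_const x (0 : ℝ)).congr_of_eventuallyEq ?_
    filter_upwards [Iio_mem_nhds h] with v hv using hneg v (Set.Iio_subset_Iic_self hv)
  · subst h
    have h1 : HasDerivWithinAt (fun v : ℝ => max 0 v ^ (n + 2)) 0 (Set.Iic 0) 0 :=
      (hasDerivWithinAt_const (0 : ℝ) _ (0 : ℝ)).congr hneg (hneg 0 (by simp))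
    have h2 : HasDerivWithinAt (fun v : ℝ => max 0 v ^ (n + 2)) 0 (Set.Ici 0) 0 := by
      have := hpow.hasDerivWithinAt (s := Set.Ici 0)
      simp only [ne_eq, Nat.add_eq_zero_iff, one_ne_zero, and_false, not_false_eq_true, zero_pow,
        mul_zero] at this
      exact this.congr hpos (hpos 0 (by simp))
    have := h1.union h2
    rw [Set.Iic_union_Ici, hasDerivWithinAt_univ] at this
    simpa using this
  · rw [max_eq_right h.le]
    refine hpow.congr_of_eventuallyEq ?_
    filter_upwards [Ioi_mem_nhds h] with v hv using hpos v (Set.Ioi_subset_Ici_self hv)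

/-- A `C²` bump supported in `[-w, w]`, of height `w ^ 2 / 48`, with second derivative of size at
most `1 / 8`. -/
noncomputable def bump (w u : ℝ) : ℝ := w ^ 2 / 48 * max 0 (1 - u ^ 2 / w ^ 2) ^ 3

/-- The derivative of `bump w`. -/
noncomputable def bumpDeriv (w u : ℝ) : ℝ := -(u / 8) * max 0 (1 - u ^ 2 / w ^ 2) ^ 2

/-- The second derivative of `bump w`. -/
noncomputable def bumpDeriv₂ (w u : ℝ) : ℝ :=
  -(1 / 8) * max 0 (1 - u ^ 2 / w ^ 2) ^ 2 + u ^ 2 / (2 * w ^ 2) * max 0 (1 - u ^ 2 / w ^ 2)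

section bump

variable {w : ℝ}

theorem hasDerivAt_one_sub_sq_div (w u : ℝ) :
    HasDerivAt (fun u : ℝ => 1 - u ^ 2 / w ^ 2) (-(2 * u / w ^ 2)) u := by
  have := ((hasDerivAt_pow 2 u).div_const (w ^ 2)).const_sub 1
  simpa using this

theorem hasDerivAt_bump (hw : 0 < w) (u : ℝ) : HasDerivAt (bump w) (bumpDeriv w u) u := by
  have h := ((hasDerivAt_max_zero_pow 1 (1 - u ^ 2 / w ^ 2)).comp u
    (hasDerivAt_one_sub_sq_div w u)).const_mul (w ^ 2 / 48)
  refine h.congr_deriv ?_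
  unfold bumpDeriv
  push_cast
  field_simp
  ring

theorem hasDerivAt_bumpDeriv (hw : 0 < w) (u : ℝ) :
    HasDerivAt (bumpDeriv w) (bumpDeriv₂ w u) u := by
  have h := (((hasDerivAt_id u).div_const 8).neg).mul
    ((hasDerivAt_max_zero_pow 0 (1 - u ^ 2 / w ^ 2)).comp u (hasDerivAt_one_sub_sq_div w u))
  refine h.congr_deriv ?_
  unfold bumpDeriv₂
  simp only [id, Function.comp, Pi.neg_apply]
  push_cast
  field_simp
  ring

theorem continuous_bumpDeriv₂ (w : ℝ) : Continuous (bumpDeriv₂ w) := by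
  unfold bumpDeriv₂
  fun_prop

theorem sq_div_sq_nonneg (u w : ℝ) : 0 ≤ u ^ 2 / w ^ 2 := by positivity

theorem max_bump_le_one (u : ℝ) : max 0 (1 - u ^ 2 / w ^ 2) ≤ 1 :=
  max_le zero_le_one (by have := sq_div_sq_nonneg u w; linarith)

/-- With `s = u² / w²` the value inside the support is `(1 - s) (5 s - 1) / 8`. The worst case is
the centre `s = 0`, whatever `w` is; this is why the height may grow like `w²`. -/
theorem abs_bumpDeriv₂_le (w u : ℝ) : |bumpDeriv₂ w u| ≤ 1 / 8 := by
  unfold bumpDeriv₂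
  have hs := sq_div_sq_nonneg u w
  rw [show u ^ 2 / (2 * w ^ 2) = (u ^ 2 / w ^ 2) / 2 by rw [div_div, mul_comm]]
  generalize u ^ 2 / w ^ 2 = s at *
  rcases le_total (1 - s) 0 with h | h
  · rw [max_eq_left h]; norm_num
  · rw [max_eq_right h, abs_le]
    constructor
    · nlinarith [mul_nonneg hs h]
    · nlinarith [sq_nonneg (s - 1 / 2), sq_nonneg (1 - s)]

theorem bump_nonneg (w u : ℝ) : 0 ≤ bump w u := by
  unfold bump; positivity

theorem bump_le (w u : ℝ) : bump w u ≤ w ^ 2 / 48 := by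
  unfold bump
  have : max 0 (1 - u ^ 2 / w ^ 2) ^ 3 ≤ 1 := pow_le_one₀ (le_max_left _ _) (max_bump_le_one u)
  nlinarith [sq_nonneg w]

theorem max_bump_eq_zero (hw : 0 < w) {u : ℝ} (hu : w ≤ |u|) :
    max 0 (1 - u ^ 2 / w ^ 2) = 0 := by
  refine max_eq_left ?_
  have : 1 ≤ u ^ 2 / w ^ 2 := by
    rw [le_div_iff₀ (by positivity), ← sq_abs u]
    nlinarith
  linarith

theorem bump_eq_zero (hw : 0 < w) {u : ℝ} (hu : w ≤ |u|) : bump w u = 0 := by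
  simp [bump, max_bump_eq_zero hw hu]

theorem bumpDeriv_eq_zero (hw : 0 < w) {u : ℝ} (hu : w ≤ |u|) : bumpDeriv w u = 0 := by
  simp [bumpDeriv, max_bump_eq_zero hw hu]

theorem bump_le_of_abs_le {u v : ℝ} (h : |u| ≤ |v|) : bump w v ≤ bump w u := by
  unfold bump
  have := sq_le_sq.2 h
  gcongr

/-- Near its top the bump loses at most a fraction `3 / w²` of its height `w² / 48`, hence a
constant independent of `w`. -/
theorem le_bump_of_abs_le_one (hw : 0 < w) {u : ℝ} (hu : |u| ≤ 1) :
    w ^ 2 / 48 - 1 / 16 ≤ bump w u := by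
  unfold bump
  set m := max 0 (1 - u ^ 2 / w ^ 2) with hm
  have h0 : 0 ≤ m := le_max_left _ _
  have h1 : m ≤ 1 := max_bump_le_one u
  have h2 : 1 - 1 / w ^ 2 ≤ m := by
    refine le_trans ?_ (le_max_right _ _)
    have : u ^ 2 ≤ 1 := by rw [← sq_abs]; nlinarith [abs_nonneg u]
    gcongr
  have h3 : 1 - 3 / w ^ 2 ≤ m ^ 3 := by
    -- The tangent line of the cube at `1`.
    have : 3 * m - 2 ≤ m ^ 3 := by nlinarith [mul_nonneg h0 (sq_nonneg (m - 1)), sq_nonneg (m - 1)]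
    have e : (3 : ℝ) / w ^ 2 = 3 * (1 / w ^ 2) := by ring
    linarith
  calc w ^ 2 / 48 - 1 / 16 = w ^ 2 / 48 * (1 - 3 / w ^ 2) := by field_simp; ring
    _ ≤ _ := by gcongr

/-- Inside the support `(1 - s)³ ≤ 1 - s`, so the bump lies below a parabola. The extra mass is then
a Gaussian integral times the exponential of the height, with no factor `w`. -/
theorem exp_bump_le (hw : 0 < w) (u : ℝ) :
    Real.exp (bump w u) ≤ 1 + Real.exp (w ^ 2 / 48) * Real.exp (-(1 / 48) * u ^ 2) := by
  rcases le_total w |u| with h | h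
  · rw [bump_eq_zero hw h, Real.exp_zero]
    have : 0 ≤ Real.exp (w ^ 2 / 48) * Real.exp (-(1 / 48) * u ^ 2) := by positivity
    linarith
  · rw [← Real.exp_add]
    have : bump w u ≤ w ^ 2 / 48 + -(1 / 48) * u ^ 2 := by
      unfold bump
      have hs := sq_div_sq_nonneg u w
      have hs1 : u ^ 2 / w ^ 2 ≤ 1 := by
        rw [div_le_one (by positivity), ← sq_abs u]
        exact pow_le_pow_left₀ (abs_nonneg _) h 2
      have e : w ^ 2 / 48 + -(1 / 48) * u ^ 2 = w ^ 2 / 48 * (1 - u ^ 2 / w ^ 2) := by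
        field_simp; ring
      rw [e]
      gcongr
      rw [max_eq_right (by linarith)]
      exact pow_le_of_le_one (by linarith) (by linarith) (by norm_num)
    have := Real.exp_le_exp.2 this
    linarith

end bump

/-! ### The wide well with a hole -/

/-- A wide Gaussian well of scale `R`. -/
noncomputable def wellPotential (R x : ℝ) : ℝ := x ^ 2 / (2 * R ^ 2)

/-- The wide Gaussian well, with a deep narrow hole dug around `a`. -/
noncomputable def holePotential (R w a x : ℝ) : ℝ := wellPotential R x - bump w (x - a)

theorem contDiff_two_of_hasDerivAt {f f' f'' : ℝ → ℝ} (h : ∀ x, HasDerivAt f (f' x) x)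
    (h' : ∀ x, HasDerivAt f' (f'' x) x) (hc : Continuous f'') : ContDiff ℝ 2 f := by
  have e : deriv f = f' := funext fun x => (h x).deriv
  have e' : deriv f' = f'' := funext fun x => (h' x).deriv
  rw [show (2 : WithTop ℕ∞) = 1 + 1 from by norm_num, contDiff_succ_iff_deriv]
  refine ⟨fun x => (h x).differentiableAt, by simp, ?_⟩
  rw [e, contDiff_one_iff_deriv, e']
  exact ⟨fun x => (h' x).differentiableAt, hc⟩

theorem isLogSmoothPotential_of_hasDerivAt {β : ℝ} {f f' f'' : ℝ → ℝ}
    (h : ∀ x, HasDerivAt f (f' x) x) (h' : ∀ x, HasDerivAt f' (f'' x) x) (hc : Continuous f'')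
    (hβ : ∀ x, |f'' x| ≤ β) (hi : Integrable (fun x => Real.exp (-f x)) volume) :
    IsLogSmoothPotential β f where
  contDiff := contDiff_two_of_hasDerivAt h h' hc
  lipschitz x y := by
    rw [(h x).deriv, (h y).deriv]
    exact Convex.norm_image_sub_le_of_norm_hasDerivWithin_le (s := Set.univ)
      (fun x _ => (h' x).hasDerivWithinAt) (fun x _ => hβ x) convex_univ trivial trivial
  integrable := hi

section potentials

variable {R w a : ℝ}

theorem hasDerivAt_wellPotential (R x : ℝ) : HasDerivAt (wellPotential R) (x / R ^ 2) x := by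
  have := (hasDerivAt_pow 2 x).div_const (2 * R ^ 2)
  refine this.congr_deriv ?_
  rw [show ((2 : ℕ) : ℝ) * x ^ (2 - 1) = 2 * x by norm_num, mul_div_mul_left _ _ two_ne_zero]

theorem hasDerivAt_holePotential (hw : 0 < w) (x : ℝ) :
    HasDerivAt (holePotential R w a) (x / R ^ 2 - bumpDeriv w (x - a)) x :=
  (hasDerivAt_wellPotential R x).sub ((hasDerivAt_bump hw (x - a)).comp_sub_const x a)

theorem wellPotential_nonneg (R x : ℝ) : 0 ≤ wellPotential R x := by
  unfold wellPotential; positivity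

theorem continuous_wellPotential (R : ℝ) : Continuous (wellPotential R) :=
  continuous_iff_continuousAt.2 fun x => (hasDerivAt_wellPotential R x).continuousAt

theorem continuous_holePotential (hw : 0 < w) : Continuous (holePotential R w a) :=
  continuous_iff_continuousAt.2 fun x => (hasDerivAt_holePotential hw x).continuousAt

theorem exp_neg_wellPotential (R x : ℝ) :
    Real.exp (-wellPotential R x) = Real.exp (-(1 / (2 * R ^ 2)) * x ^ 2) := by
  unfold wellPotential; congr 1; ring

theorem integrable_exp_neg_wellPotential (hR : 0 < R) :
    Integrable (fun x => Real.exp (-wellPotential R x)) volume := by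
  simp_rw [exp_neg_wellPotential]
  exact integrable_exp_neg_mul_sq (by positivity)

theorem integrable_exp_neg_holePotential (hR : 0 < R) (hw : 0 < w) :
    Integrable (fun x => Real.exp (-holePotential R w a x)) volume := by
  refine ((integrable_exp_neg_wellPotential hR).const_mul (Real.exp (w ^ 2 / 48))).mono'
    (Real.continuous_exp.comp (continuous_holePotential hw).neg).aestronglyMeasurable
    (Filter.Eventually.of_forall fun x => ?_)
  rw [Real.norm_eq_abs, Real.abs_exp, ← Real.exp_add, Real.exp_le_exp]
  have := bump_le w (x - a)
  unfold holePotential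
  linarith

theorem inv_sq_le (hR : 2 ≤ R) : 1 / R ^ 2 ≤ 1 / 4 := by
  have : (4 : ℝ) ≤ R ^ 2 := by nlinarith
  gcongr

theorem isLogSmoothPotential_holePotential (hR : 2 ≤ R) (hw : 0 < w) :
    IsLogSmoothPotential 1 (holePotential R w a) := by
  refine isLogSmoothPotential_of_hasDerivAt
    (f'' := fun x => 1 / R ^ 2 - bumpDeriv₂ w (x - a))
    (hasDerivAt_holePotential hw)
    (fun x => ((hasDerivAt_id x).div_const _).sub
      ((hasDerivAt_bumpDeriv hw (x - a)).comp_sub_const x a))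
    (continuous_const.sub ((continuous_bumpDeriv₂ w).comp (continuous_id.sub continuous_const)))
    (fun x => ?_) (integrable_exp_neg_holePotential (by linarith) hw)
  -- The curvatures add up to at most `1/4 + 1/8`.
  have h1 := abs_le.1 (abs_bumpDeriv₂_le w (x - a))
  have h2 := inv_sq_le hR
  have h3 : 0 ≤ 1 / R ^ 2 := by positivity
  rw [abs_le]
  constructor <;> linarith [h1.1, h1.2]

theorem holePotential_eq_of_le_abs (hw : 0 < w) {x : ℝ} (hx : w ≤ |x - a|) :
    holePotential R w a x = wellPotential R x := by
  simp [holePotential, bump_eq_zero hw hx]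

theorem deriv_holePotential_eq_of_le_abs (hw : 0 < w) {x : ℝ} (hx : w ≤ |x - a|) :
    deriv (holePotential R w a) x = deriv (wellPotential R) x := by
  rw [(hasDerivAt_holePotential hw x).deriv, (hasDerivAt_wellPotential R x).deriv,
    bumpDeriv_eq_zero hw hx, sub_zero]

/-- Moving away from the hole, the potential grows quadratically up to an additive constant. -/
theorem holePotential_growth (hR : 0 < R) (hw : 0 < w) {x y : ℝ}
    (h : (-R ≤ y ∧ a - 1 ≤ y ∧ y ≤ x) ∨ (y ≤ R ∧ y ≤ a + 1 ∧ x ≤ y)) :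
    holePotential R w a y + 1 / (4 * R ^ 2) * (x - y) ^ 2 - 2 ≤ holePotential R w a x := by
  have hwell : wellPotential R y + 1 / (4 * R ^ 2) * (x - y) ^ 2 - 1 ≤ wellPotential R x := by
    have e : wellPotential R x - (wellPotential R y + 1 / (4 * R ^ 2) * (x - y) ^ 2 - 1) =
        ((x - y) ^ 2 + 4 * y * (x - y) + 4 * R ^ 2) / (4 * R ^ 2) := by
      unfold wellPotential; field_simp; ring
    have h0 : 0 ≤ (x - y) ^ 2 + 4 * y * (x - y) + 4 * R ^ 2 := by
      -- Replacing `y` by its extreme value `∓R` turns the quadratic into a perfect square.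
      have h1 : 0 ≤ (R + y) * (x - y) ∨ 0 ≤ (R - y) * (y - x) := by
        rcases h with h | h
        · exact Or.inl (mul_nonneg (by linarith) (by linarith))
        · exact Or.inr (mul_nonneg (by linarith) (by linarith))
      rcases h1 with h1 | h1
      · nlinarith [sq_nonneg (x - y - 2 * R)]
      · nlinarith [sq_nonneg (x - y + 2 * R)]
    have : 0 ≤ ((x - y) ^ 2 + 4 * y * (x - y) + 4 * R ^ 2) / (4 * R ^ 2) := by positivity
    linarith
  -- Outside the unit core the bump decreases away from `a`; inside it, it is within `1/16` of its
  -- maximum.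
  have hbump : bump w (x - a) ≤ bump w (y - a) + 1 / 16 := by
    rcases le_or_gt |y - a| 1 with h1 | h1
    · linarith [le_bump_of_abs_le_one hw h1, bump_le w (x - a)]
    · have : |y - a| ≤ |x - a| := by
        rcases h with h | h
        · have : 1 ≤ y - a := by
            rcases lt_abs.1 h1 with h2 | h2 <;> linarith
          rw [abs_of_nonneg (by linarith), abs_of_nonneg (by linarith)]; linarith
        · have : y - a ≤ -1 := by
            rcases lt_abs.1 h1 with h2 | h2 <;> linarith
          rw [abs_of_nonpos (by linarith), abs_of_nonpos (by linarith)]; linarith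
      linarith [bump_le_of_abs_le (w := w) this]
  unfold holePotential
  linarith

/-! ### Tails, mass of the hole, and the warm start -/

theorem exp_two_le : Real.exp 2 ≤ 8 := by
  have h := Real.exp_one_lt_d9
  have : Real.exp 2 = Real.exp 1 ^ 2 := by rw [← Real.exp_nat_mul]; norm_num
  rw [this]
  nlinarith [Real.exp_pos 1]

theorem integral_exp_shift_le (hR : 0 < R) (y : ℝ) :
    ∫ x, Real.exp (-(1 / (4 * R ^ 2)) * (x - y) ^ 2) ≤ 4 * R := by
  rw [integral_sub_right_eq_self (fun x => Real.exp (-(1 / (4 * R ^ 2)) * x ^ 2)) y,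
    integral_gaussian]
  rw [Real.sqrt_le_iff]
  refine ⟨by positivity, ?_⟩
  have : Real.pi / (1 / (4 * R ^ 2)) = Real.pi * (4 * R ^ 2) := by field_simp
  rw [this]
  nlinarith [Real.pi_le_four, sq_nonneg R]

/-- The quadratic growth away from `y` dominates the tail by a Gaussian of scale `R`; `32` is `8 ≥
exp 2` times the `4` of `integral_exp_shift_le`. -/
theorem lintegral_exp_neg_holePotential_le (hR : 0 < R) (hw : 0 < w) {y : ℝ} {s : Set ℝ}
    (hs : MeasurableSet s)
    (h : ∀ x ∈ s, (-R ≤ y ∧ a - 1 ≤ y ∧ y ≤ x) ∨ (y ≤ R ∧ y ≤ a + 1 ∧ x ≤ y)) :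
    ∫⁻ x in s, ENNReal.ofReal (Real.exp (-holePotential R w a x)) ≤
      ENNReal.ofReal (32 * R) * ENNReal.ofReal (Real.exp (-holePotential R w a y)) := by
  set c := 8 * Real.exp (-holePotential R w a y)
  have hi : Integrable (fun x : ℝ => Real.exp (-(1 / (4 * R ^ 2)) * (x - y) ^ 2)) volume :=
    (integrable_exp_neg_mul_sq (b := 1 / (4 * R ^ 2)) (by positivity)).comp_sub_right y
  calc ∫⁻ x in s, ENNReal.ofReal (Real.exp (-holePotential R w a x))
      ≤ ∫⁻ x in s, ENNReal.ofReal (c * Real.exp (-(1 / (4 * R ^ 2)) * (x - y) ^ 2)) := by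
        refine setLIntegral_mono' hs fun x hx => ENNReal.ofReal_le_ofReal ?_
        have h1 := holePotential_growth hR hw (h x hx)
        calc Real.exp (-holePotential R w a x)
            ≤ Real.exp (2 + (-holePotential R w a y + -(1 / (4 * R ^ 2)) * (x - y) ^ 2)) := by
              rw [Real.exp_le_exp]; linarith
          _ = Real.exp 2 * (Real.exp (-holePotential R w a y) *
                Real.exp (-(1 / (4 * R ^ 2)) * (x - y) ^ 2)) := by
              rw [Real.exp_add, Real.exp_add]
          _ ≤ 8 * (Real.exp (-holePotential R w a y) *
                Real.exp (-(1 / (4 * R ^ 2)) * (x - y) ^ 2)) := by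
              gcongr; exact exp_two_le
          _ = _ := by ring
    _ ≤ ∫⁻ x, ENNReal.ofReal (c * Real.exp (-(1 / (4 * R ^ 2)) * (x - y) ^ 2)) :=
        setLIntegral_le_lintegral _ _
    _ = ENNReal.ofReal (∫ x, c * Real.exp (-(1 / (4 * R ^ 2)) * (x - y) ^ 2)) := by
        rw [ofReal_integral_eq_lintegral_ofReal (hi.const_mul c)
          (Filter.Eventually.of_forall fun x => by positivity)]
    _ ≤ ENNReal.ofReal (32 * R * Real.exp (-holePotential R w a y)) := by
        refine ENNReal.ofReal_le_ofReal ?_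
        rw [integral_const_mul]
        have := integral_exp_shift_le hR y
        calc c * _ ≤ c * (4 * R) := by gcongr
          _ = _ := by ring
    _ = _ := ENNReal.ofReal_mul (by positivity)

theorem integral_exp_neg_holePotential_le (hR : 0 < R) (hw : 0 < w)
    (hRw : R ≤ Real.exp (w ^ 2 / 48)) :
    ∫ x, Real.exp (-holePotential R w a x) ≤ 17 * Real.exp (w ^ 2 / 48) := by
  have hi2 : Integrable (fun x : ℝ => Real.exp (-(1 / 48) * (x - a) ^ 2)) volume :=
    (integrable_exp_neg_mul_sq (b := 1 / 48) (by positivity)).comp_sub_right a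
  have hi1 := integrable_exp_neg_wellPotential hR
  have h1 : ∫ x, Real.exp (-wellPotential R x) ≤ 3 * R := by
    simp_rw [exp_neg_wellPotential]
    rw [integral_gaussian, Real.sqrt_le_iff]
    refine ⟨by positivity, ?_⟩
    have : Real.pi / (1 / (2 * R ^ 2)) = Real.pi * (2 * R ^ 2) := by field_simp
    rw [this]
    nlinarith [Real.pi_le_four, sq_nonneg R]
  have h2 : ∫ x, Real.exp (-(1 / 48) * (x - a) ^ 2) ≤ 14 := by
    rw [integral_sub_right_eq_self (fun x => Real.exp (-(1 / 48) * x ^ 2)) a, integral_gaussian,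
      Real.sqrt_le_iff]
    refine ⟨by positivity, ?_⟩
    have : Real.pi / (1 / 48) = Real.pi * 48 := by ring
    rw [this]
    nlinarith [Real.pi_le_four]
  calc ∫ x, Real.exp (-holePotential R w a x)
      ≤ ∫ x, (Real.exp (-wellPotential R x) +
          Real.exp (w ^ 2 / 48) * Real.exp (-(1 / 48) * (x - a) ^ 2)) := by
        refine integral_mono (integrable_exp_neg_holePotential hR hw)
          (hi1.add (hi2.const_mul _)) fun x => ?_
        have e : Real.exp (-holePotential R w a x) =
            Real.exp (-wellPotential R x) * Real.exp (bump w (x - a)) := by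
          rw [← Real.exp_add]; congr 1; unfold holePotential; ring
        have h3 : Real.exp (-wellPotential R x) ≤ 1 :=
          Real.exp_le_one_iff.2 (by linarith [wellPotential_nonneg R x])
        have h4 := exp_bump_le hw (x - a)
        simp only [e]
        calc _ ≤ Real.exp (-wellPotential R x) *
              (1 + Real.exp (w ^ 2 / 48) * Real.exp (-(1 / 48) * (x - a) ^ 2)) := by gcongr
          _ = Real.exp (-wellPotential R x) + Real.exp (-wellPotential R x) *
              (Real.exp (w ^ 2 / 48) * Real.exp (-(1 / 48) * (x - a) ^ 2)) := by ring
          _ ≤ Real.exp (-wellPotential R x) + 1 *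
              (Real.exp (w ^ 2 / 48) * Real.exp (-(1 / 48) * (x - a) ^ 2)) := by gcongr
          _ = _ := by ring
    _ = (∫ x, Real.exp (-wellPotential R x)) +
          Real.exp (w ^ 2 / 48) * ∫ x, Real.exp (-(1 / 48) * (x - a) ^ 2) := by
        rw [integral_add hi1 (hi2.const_mul _), integral_const_mul]
    _ ≤ 3 * R + Real.exp (w ^ 2 / 48) * 14 := by gcongr
    _ ≤ _ := by linarith

/-- On this interval of length `2` the unnormalised density is at least a quarter of `exp (w ^ 2 /
48)`, while the normalising constant is at most `17` times that number. The condition on `R` keeps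
the well from outweighing the hole. -/
theorem le_gibbs_holePotential (hR : 0 < R) (hw : 0 < w)
    (hRw : R ≤ Real.exp (w ^ 2 / 48)) (ha : |a| + 1 ≤ R) :
    ENNReal.ofReal (1 / 34) ≤ gibbs (holePotential R w a) (Set.Icc (a - 1) (a + 1)) := by
  have hi := integrable_exp_neg_holePotential (a := a) hR hw
  have hZ := integral_exp_neg_holePotential_le (a := a) hR hw hRw
  have hZ0 : 0 < ∫ x, Real.exp (-holePotential R w a x) := integral_exp_pos hi
  unfold gibbs
  rw [tilted_apply_eq_ofReal_integral' _ measurableSet_Icc]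
  refine ENNReal.ofReal_le_ofReal ?_
  rw [integral_div, le_div_iff₀ hZ0]
  have h1 : ∫ x in Set.Icc (a - 1) (a + 1), Real.exp (w ^ 2 / 48) * (1 / 4) ≤
      ∫ x in Set.Icc (a - 1) (a + 1), Real.exp (-holePotential R w a x) := by
    refine setIntegral_mono_on (integrableOn_const (by simp)) hi.integrableOn measurableSet_Icc fun x hx => ?_
    have hxa : |x - a| ≤ 1 := abs_le.2 ⟨by linarith [hx.1], by linarith [hx.2]⟩
    have h2 := le_bump_of_abs_le_one hw hxa
    have h3 : wellPotential R x ≤ 1 / 2 := by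
      have hxR : |x| ≤ R := by
        calc |x| = |(x - a) + a| := by ring_nf
          _ ≤ |x - a| + |a| := abs_add_le _ _
          _ ≤ R := by linarith
      unfold wellPotential
      rw [div_le_iff₀ (by positivity), ← sq_abs]
      nlinarith [pow_le_pow_left₀ (abs_nonneg x) hxR 2]
    have h4 : Real.exp (-1) ≥ 1 / 4 := by
      rw [Real.exp_neg, ge_iff_le, one_div]
      exact inv_anti₀ (Real.exp_pos 1) (by linarith [Real.exp_one_lt_d9])
    calc Real.exp (w ^ 2 / 48) * (1 / 4) ≤ Real.exp (w ^ 2 / 48) * Real.exp (-1) := by gcongr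
      _ ≤ _ := by
        rw [← Real.exp_add, Real.exp_le_exp]
        unfold holePotential
        linarith
  have h2 : ∫ x in Set.Icc (a - 1) (a + 1), Real.exp (w ^ 2 / 48) * (1 / 4) =
      Real.exp (w ^ 2 / 48) * (1 / 2) := by
    rw [setIntegral_const, measureReal_def, Real.volume_Icc,
      ENNReal.toReal_ofReal (by linarith), smul_eq_mul]
    ring
  rw [h2] at h1
  linarith

/-- Each measure is a tilt of the other by a function with values in an interval of length `w ^ 2 /
48`. In each log-ratio, one of the tilt and its log-normaliser has a favourable sign and the other
contributes at most that length. -/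
theorem isWarmStart_holePotential (hR : 0 < R) (hw : 0 < w) {M : ℝ} (hM : w ^ 2 / 48 ≤ M) :
    IsWarmStart M (gibbs (wellPotential R)) (gibbs (holePotential R w a)) := by
  have hi0 := integrable_exp_neg_wellPotential hR
  have hi1 := integrable_exp_neg_holePotential (a := a) hR hw
  have e1 : gibbs (holePotential R w a) =
      (gibbs (wellPotential R)).tilted (fun x => bump w (x - a)) := by
    unfold gibbs
    rw [tilted_tilted hi0]
    congr 1; funext x; simp only [Pi.add_apply, holePotential]; ring
  have e0 : gibbs (wellPotential R) =
      (gibbs (holePotential R w a)).tilted (fun x => -bump w (x - a)) := by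
    unfold gibbs
    rw [tilted_tilted hi1]
    congr 1; funext x; simp only [Pi.add_apply, holePotential]; ring
  have : IsProbabilityMeasure (gibbs (wellPotential R)) := isProbabilityMeasure_tilted hi0
  have : IsProbabilityMeasure (gibbs (holePotential R w a)) := isProbabilityMeasure_tilted hi1
  have hbc : Continuous fun x => bump w (x - a) := by unfold bump; fun_prop
  have hint : ∀ (s : ℝ) (μ : Measure ℝ) [IsProbabilityMeasure μ],
      Integrable (fun x => Real.exp (s * bump w (x - a))) μ := by
    intro s μ _
    refine Integrable.of_bound (C := Real.exp (|s| * (w ^ 2 / 48)))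
      (Real.continuous_exp.comp (hbc.const_mul s)).aestronglyMeasurable
      (Filter.Eventually.of_forall fun x => ?_)
    rw [Real.norm_eq_abs, Real.abs_exp, Real.exp_le_exp]
    have := bump_nonneg w (x - a)
    calc s * bump w (x - a) ≤ |s| * bump w (x - a) := by gcongr; exact le_abs_self s
      _ ≤ _ := by gcongr; exact bump_le _ _
  have hb1 := hint 1 (gibbs (wellPotential R))
  have hb0 := hint (-1) (gibbs (holePotential R w a))
  simp only [one_mul, neg_mul] at hb1 hb0
  have hac : gibbs (holePotential R w a) ≪ gibbs (wellPotential R) := by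
    rw [e1]; exact tilted_absolutelyContinuous _ _
  have hac' : gibbs (wellPotential R) ≪ gibbs (holePotential R w a) := by
    conv_lhs => rw [e0]
    exact tilted_absolutelyContinuous _ _
  refine ⟨hac', hac, ?_, ?_⟩
  · have h := log_rnDeriv_tilted_left_self hb0
    rw [← e0] at h
    filter_upwards [h] with x hx
    unfold llr
    rw [hx]
    have h1 : Real.exp (-(w ^ 2 / 48)) ≤
        ∫ x, Real.exp (-bump w (x - a)) ∂gibbs (holePotential R w a) := by
      have := integral_mono (integrable_const (Real.exp (-(w ^ 2 / 48)))) hb0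
        (fun x => Real.exp_le_exp.2 (neg_le_neg (bump_le w (x - a))))
      simpa using this
    have h2 := Real.log_le_log (Real.exp_pos _) h1
    rw [Real.log_exp] at h2
    linarith [bump_nonneg w (x - a)]
  · have h := log_rnDeriv_tilted_left_self hb1
    rw [← e1] at h
    filter_upwards [hac.ae_le h] with x hx
    unfold llr
    rw [hx]
    have h1 : 1 ≤ ∫ x, Real.exp (bump w (x - a)) ∂gibbs (wellPotential R) := by
      have := integral_mono (integrable_const (1 : ℝ)) hb1
        (fun x => Real.one_le_exp (bump_nonneg w (x - a)))
      simpa using this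
    linarith [Real.log_nonneg h1, bump_le w (x - a)]

/-- A measure with small Fisher information relative to the holed well charges the hole. -/
theorem gibbs_holePotential_le (hR : 0 < R) (hw : 0 < w) (ha : |a| + 1 ≤ R) {ε : ℝ} (hε : 0 < ε)
    {μ : Measure ℝ} [IsProbabilityMeasure μ]
    (hFI : fisherInfo μ (gibbs (holePotential R w a)) ^ (1 / 2 : ℝ) ≤ ENNReal.ofReal ε) :
    gibbs (holePotential R w a) (Set.Icc (a - 1) (a + 1)) ≤ μ (Set.Icc (a - 1) (a + 1)) +
      gibbs (holePotential R w a) (Set.Icc (a - 1) (a + 1)) *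
        (ENNReal.ofReal (32 * R) * ENNReal.ofReal (2 * ε)) := by
  have hi := integrable_exp_neg_holePotential (a := a) hR hw
  have hc : Continuous (holePotential R w a) := continuous_holePotential hw
  have ha1 := abs_le.1 (show |a| ≤ R - 1 by linarith)
  set Z := ∫ x, Real.exp (-holePotential R w a x) with hZ
  have hZ0 : 0 < Z := integral_exp_pos hi
  have hg : gibbs (holePotential R w a) =
      volume.withDensity fun x => ENNReal.ofReal (Real.exp (-holePotential R w a x) / Z) := rfl
  have hp : IsProbabilityMeasure (gibbs (holePotential R w a)) := isProbabilityMeasure_tilted hi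
  have hm : Measurable fun x => ENNReal.ofReal (Real.exp (-holePotential R w a x)) := by fun_prop
  have he : ∀ x, ENNReal.ofReal (Real.exp (-holePotential R w a x) / Z) =
      ENNReal.ofReal (Real.exp (-holePotential R w a x)) * ENNReal.ofReal Z⁻¹ := fun x => by
    rw [div_eq_mul_inv, ENNReal.ofReal_mul (Real.exp_pos _).le]
  rw [hg] at hFI hp ⊢
  refine measure_le_of_fisherInfo_le (by fun_prop) hε hFI (fun y hy => ?_) (fun y hy => ?_)
  · simp_rw [he]
    rw [lintegral_mul_const _ hm, ← mul_assoc]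
    gcongr
    exact lintegral_exp_neg_holePotential_le hR hw measurableSet_Ici
      fun x hx => Or.inl ⟨by linarith, hy, hx⟩
  · simp_rw [he]
    rw [lintegral_mul_const _ hm, ← mul_assoc]
    gcongr
    exact lintegral_exp_neg_holePotential_le hR hw measurableSet_Iic
      fun x hx => Or.inr ⟨by linarith, hy, hx⟩

end potentials

/-! ### Few queries cannot locate the hole -/

namespace QueryAlgorithm

variable {N : ℕ} (A : QueryAlgorithm N) (μ₀ : Measure ℝ)

theorem measurable_transcript {V : ℝ → ℝ} (hV : Measurable V) (n : ℕ) :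
    Measurable fun p : A.Seed × (ℕ → ℝ) => A.transcript μ₀ V p.1 p.2 n := by
  induction n with
  | zero =>
    exact measurable_pi_iff.2 fun i => i.elim0
  | succ n ih =>
    have hq : Measurable fun p : A.Seed × (ℕ → ℝ) =>
        A.query μ₀ n (p.1, p.2, A.transcript μ₀ V p.1 p.2 n) :=
      (A.measurable_query μ₀ n).comp (measurable_fst.prodMk (measurable_snd.prodMk ih))
    refine measurable_pi_iff.2 fun i => ?_
    refine Fin.lastCases ?_ (fun j => ?_) i
    · simp only [transcript, Fin.snoc_last]
      exact hq.prodMk ((hV.comp hq).prodMk ((measurable_deriv V).comp hq))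
    · simp only [transcript, Fin.snoc_castSucc]
      exact (measurable_pi_apply j).comp ih

/-- The `n`-th query point. -/
noncomputable def queryPoint (V : ℝ → ℝ) (n : ℕ) (p : A.Seed × (ℕ → ℝ)) : ℝ :=
  A.query μ₀ n (p.1, p.2, A.transcript μ₀ V p.1 p.2 n)

/-- The output, as a function of the seed and of the samples. -/
noncomputable def result (V : ℝ → ℝ) (p : A.Seed × (ℕ → ℝ)) : ℝ :=
  A.output μ₀ (p.1, p.2, A.transcript μ₀ V p.1 p.2 N)

theorem measurable_queryPoint {V : ℝ → ℝ} (hV : Measurable V) (n : ℕ) :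
    Measurable (A.queryPoint μ₀ V n) :=
  (A.measurable_query μ₀ n).comp
    (measurable_fst.prodMk (measurable_snd.prodMk (A.measurable_transcript μ₀ hV n)))

theorem measurable_result {V : ℝ → ℝ} (hV : Measurable V) : Measurable (A.result μ₀ V) :=
  (A.measurable_output μ₀).comp
    (measurable_fst.prodMk (measurable_snd.prodMk (A.measurable_transcript μ₀ hV N)))

theorem isProbabilityMeasure_outputLaw [IsProbabilityMeasure μ₀] {V : ℝ → ℝ}
    (hV : Measurable V) : IsProbabilityMeasure (A.outputLaw μ₀ V) :=
  Measure.isProbabilityMeasure_map (A.measurable_result μ₀ hV).aemeasurable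

/-- An algorithm that makes no query in `S` cannot tell apart two potentials agreeing off `S`. -/
theorem transcript_congr {V V₀ : ℝ → ℝ} {S : Set ℝ}
    (h : ∀ x ∉ S, V x = V₀ x ∧ deriv V x = deriv V₀ x) (p : A.Seed × (ℕ → ℝ)) (n : ℕ)
    (hp : ∀ j < n, A.queryPoint μ₀ V₀ j p ∉ S) :
    A.transcript μ₀ V p.1 p.2 n = A.transcript μ₀ V₀ p.1 p.2 n := by
  induction n with
  | zero => rfl
  | succ n ih =>
    have e := ih fun j hj => hp j (hj.trans n.lt_succ_self)
    obtain ⟨h1, h2⟩ := h _ (hp n n.lt_succ_self)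
    unfold queryPoint at h1 h2
    simp only [transcript, e, h1, h2]

theorem sum_measure_preimage_le_one {Ω ι : Type*} [MeasurableSpace Ω] [Fintype ι]
    (P : Measure Ω) [IsProbabilityMeasure P] {X : Ω → ℝ} (hX : Measurable X) {S : ι → Set ℝ}
    (hS : ∀ i, MeasurableSet (S i)) (hd : Pairwise (Function.onFun Disjoint S)) :
    ∑ i, P (X ⁻¹' S i) ≤ 1 := by
  rw [← tsum_fintype (L := .unconditional _),
    ← measure_iUnion (fun i j hij => (hd hij).preimage X) fun i => hX (hS i)]
  exact prob_le_one

/-- Among `n` potentials that differ from `V₀` only on disjoint sets, one is such that the output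
of an algorithm with `N` queries seldom lies in the corresponding set. -/
theorem exists_outputLaw_le [IsProbabilityMeasure μ₀] {V₀ : ℝ → ℝ} (hV₀ : Measurable V₀) {n : ℕ}
    (hn : 0 < n) {V : Fin n → ℝ → ℝ} (hV : ∀ i, Measurable (V i)) {S : Fin n → Set ℝ}
    (hS : ∀ i, MeasurableSet (S i)) (hd : Pairwise (Function.onFun Disjoint S))
    (h : ∀ i, ∀ x ∉ S i, V i x = V₀ x ∧ deriv (V i) x = deriv V₀ x) :
    ∃ i, n * A.outputLaw μ₀ (V i) (S i) ≤ N + 1 := by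
  set P := A.seedLaw.prod (Measure.infinitePi (fun _ : ℕ => μ₀)) with hP
  -- Run the algorithm on `V i` and on `V₀` with the same seed and samples. Unless a query of the
  -- `V₀` run hits `S i`, the two outputs coincide.
  have hle : ∀ i, A.outputLaw μ₀ (V i) (S i) ≤
      ∑ j ∈ Finset.range N, P (A.queryPoint μ₀ V₀ j ⁻¹' S i) + P (A.result μ₀ V₀ ⁻¹' S i) := by
    intro i
    have e : A.outputLaw μ₀ (V i) (S i) = P (A.result μ₀ (V i) ⁻¹' S i) :=
      Measure.map_apply (A.measurable_result μ₀ (hV i)) (hS i)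
    rw [e]
    have hsub : A.result μ₀ (V i) ⁻¹' S i ⊆
        (⋃ j ∈ Finset.range N, A.queryPoint μ₀ V₀ j ⁻¹' S i) ∪ A.result μ₀ V₀ ⁻¹' S i := by
      intro p hp
      by_cases hq : ∃ j < N, A.queryPoint μ₀ V₀ j p ∈ S i
      · obtain ⟨j, hj, hjS⟩ := hq
        exact Or.inl (Set.mem_biUnion (Finset.mem_coe.2 (Finset.mem_range.2 hj)) hjS)
      · push Not at hq
        refine Or.inr ?_
        have e2 := A.transcript_congr μ₀ (h i) p N hq
        simp only [Set.mem_preimage, result] at hp ⊢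
        rwa [e2] at hp
    refine (measure_mono hsub).trans ((measure_union_le _ _).trans ?_)
    gcongr
    exact measure_biUnion_finset_le _ _
  -- Each of the `N` query points and the output of the `V₀` run lies in at most one `S i`, so each
  -- contributes at most `1` to the sum.
  have hsum : ∑ i, A.outputLaw μ₀ (V i) (S i) ≤ N + 1 := by
    refine (Finset.sum_le_sum fun i _ => hle i).trans ?_
    rw [Finset.sum_add_distrib, Finset.sum_comm]
    refine add_le_add ?_ (sum_measure_preimage_le_one P (A.measurable_result μ₀ hV₀) hS hd)
    refine (Finset.sum_le_sum fun j _ =>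
      sum_measure_preimage_le_one P (A.measurable_queryPoint μ₀ hV₀ j) hS hd).trans ?_
    simp
  have : Nonempty (Fin n) := ⟨⟨0, hn⟩⟩
  obtain ⟨i, -, hi⟩ := Finset.exists_min_image Finset.univ
    (fun i => A.outputLaw μ₀ (V i) (S i)) Finset.univ_nonempty
  refine ⟨i, le_trans ?_ hsum⟩
  have := Finset.card_nsmul_le_sum Finset.univ (fun i => A.outputLaw μ₀ (V i) (S i)) _ hi
  simpa using this

end QueryAlgorithm

/-! ### The lower bound -/

/-- The lower bound on the number of queries, in terms of the scale `R` of the well, the width `w`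
of the holes and the number `n` of holes that fit into the well. -/
theorem QueryAlgorithm.Achieves.le_card {N : ℕ} {A : QueryAlgorithm N} {M ε : ℝ}
    (hA : A.Achieves M ε) (hε : 0 < ε) {R w : ℝ} (hR : 2 ≤ R) (hw : 1 < w)
    (hRε : 128 * R * ε ≤ 1) (hRw : R ≤ Real.exp (w ^ 2 / 48)) (hM : w ^ 2 / 48 ≤ M) {n : ℕ}
    (hn : n * w ≤ R) : (n : ℝ) ≤ 68 * (N + 1) := by
  rcases Nat.eq_zero_or_pos n with rfl | hn0
  · simp; positivity
  have hR0 : 0 < R := by linarith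
  have hw0 : 0 < w := by linarith
  have : IsProbabilityMeasure (gibbs (wellPotential R)) :=
    isProbabilityMeasure_tilted (integrable_exp_neg_wellPotential hR0)
  -- Consecutive intervals of length `2 * w`, starting at `-R` and staying inside `[-R, R]`.
  let a : Fin n → ℝ := fun i => -R + (2 * (i : ℕ) + 1) * w
  let S : Fin n → Set ℝ := fun i => Set.Ioo (a i - w) (a i + w)
  have hwn : ∀ i : Fin n, ((i : ℕ) + 1 : ℝ) * w ≤ R := fun i => by
    have : ((i : ℕ) + 1 : ℝ) ≤ n := by exact_mod_cast i.2
    exact (mul_le_mul_of_nonneg_right this hw0.le).trans hn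
  have ha : ∀ i, |a i| + 1 ≤ R := fun i => by
    have h1 := hwn i
    have h2 : (0 : ℝ) ≤ (i : ℕ) * w := by positivity
    have : |a i| ≤ R - 1 := by
      rw [abs_le]
      constructor <;> simp only [a] <;> nlinarith
    linarith
  have hlt : ∀ i j : Fin n, i < j → Disjoint (S i) (S j) := fun i j hij => by
    rw [Set.disjoint_left]
    intro x hx hy
    have h1 : ((i : ℕ) + 1 : ℝ) ≤ (j : ℕ) := by exact_mod_cast hij
    have h2 := hx.2
    have h3 := hy.1
    simp only [a] at h2 h3
    nlinarith
  obtain ⟨i, hi⟩ := A.exists_outputLaw_le (gibbs (wellPotential R))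
    (continuous_wellPotential R).measurable hn0 (V := fun i => holePotential R w (a i))
    (fun i => (continuous_holePotential hw0).measurable) (S := S) (fun i => measurableSet_Ioo)
    (fun i j hij => (lt_or_gt_of_ne hij).elim (hlt i j) fun h => (hlt j i h).symm)
    (fun i x hx => by
      have hx' : w ≤ |x - a i| := by
        by_contra! hc
        have := abs_lt.1 hc
        exact hx ⟨by linarith [this.1], by linarith [this.2]⟩
      exact ⟨holePotential_eq_of_le_abs hw0 hx', deriv_holePotential_eq_of_le_abs hw0 hx'⟩)
  set π := gibbs (holePotential R w (a i))
  have : IsProbabilityMeasure π :=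
    isProbabilityMeasure_tilted (integrable_exp_neg_holePotential hR0 hw0)
  have : IsProbabilityMeasure (A.outputLaw (gibbs (wellPotential R)) (holePotential R w (a i))) :=
    A.isProbabilityMeasure_outputLaw _ (continuous_holePotential hw0).measurable
  set μ := A.outputLaw (gibbs (wellPotential R)) (holePotential R w (a i))
  have hFI := hA _ (isLogSmoothPotential_holePotential (a := a i) hR hw0) _
    (isWarmStart_holePotential hR0 hw0 hM)
  have hmass := ENNReal.toReal_mono (measure_ne_top _ _) (le_gibbs_holePotential hR0 hw0 hRw (ha i))
  have hsub : Set.Icc (a i - 1) (a i + 1) ⊆ S i := fun x hx =>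
    ⟨by linarith [hx.1], by linarith [hx.2]⟩
  -- The Poincaré loss is `32 * R * (2 * ε) = 64 * R * ε ≤ 1 / 2`.
  have hmain : π (Set.Icc (a i - 1) (a i + 1)) ≤
      μ (S i) + π (Set.Icc (a i - 1) (a i + 1)) * ENNReal.ofReal (1 / 2) := by
    refine (gibbs_holePotential_le hR0 hw0 (ha i) hε hFI).trans ?_
    rw [← ENNReal.ofReal_mul (by positivity)]
    gcongr
    nlinarith
  have hmain' := ENNReal.toReal_mono (by finiteness) hmain
  rw [ENNReal.toReal_add (by finiteness) (by finiteness), ENNReal.toReal_mul,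
    ENNReal.toReal_ofReal (by norm_num)] at hmain'
  rw [ENNReal.toReal_ofReal (by norm_num)] at hmass
  have hi' := ENNReal.toReal_mono (by finiteness) hi
  rw [ENNReal.toReal_mul, ENNReal.toReal_natCast, ENNReal.toReal_add (by finiteness) (by finiteness),
    ENNReal.toReal_natCast, ENNReal.toReal_one] at hi'
  have hq : 1 / 68 ≤ (μ (S i)).toReal := by linarith
  nlinarith [mul_le_mul_of_nonneg_left hq (Nat.cast_nonneg (α := ℝ) n)]

theorem corollaryD2 :
    ∃ c : ℝ, 1 < c ∧ ∃ k : ℝ, 0 < k ∧ ∀ ε : ℝ, 0 < ε → ε ≤ 1 / c →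
      ENNReal.ofReal (k * (1 / (ε * Real.sqrt (Real.log (1 / ε))))) ≤
        ((warmStartComplexity (c * Real.log (1 / ε)) ε : ℕ∞) : ℝ≥0∞) := by
  -- The bounds `T / 896 - 1 < n ≤ 68 * (N + 1)`, where `T = 1 / (ε * √L)`, give `N > T / 60928 - 69
  -- / 68`. Half of the main term, `T / 121856`, absorbs the `69 / 68` once `T ≥ 123648`.
  refine ⟨123648 ^ 2, by norm_num, 1 / 121856, by norm_num, fun ε hε hεc => ?_⟩
  set L := Real.log (1 / ε) with hL
  have hε' : ε * 123648 ^ 2 ≤ 1 := (le_div_iff₀ (by norm_num)).1 hεc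
  have hexp : Real.exp L = 1 / ε := Real.exp_log (by positivity)
  have hL1 : 1 < L := by
    rw [hL, Real.lt_log_iff_exp_lt (by positivity), lt_div_iff₀ hε]
    nlinarith [Real.exp_one_lt_d9]
  have hLε : L * ε ≤ 1 := by
    have := Real.add_one_le_exp L
    rw [hexp, le_div_iff₀ hε] at this
    nlinarith
  have hsL : 0 < √L := Real.sqrt_pos.2 (by linarith)
  have hsq : √L ^ 2 = L := Real.sq_sqrt (by linarith)
  set T := 1 / (ε * √L) with hT
  -- As `L * ε ≤ 1`, the square of `T` is at least `1 / ε`; hence the square in the choice of `c`.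
  have hTlarge : 123648 ≤ T := by
    rw [hT, le_div_iff₀ (by positivity)]
    refine abs_le_of_sq_le_sq' ?_ zero_le_one |>.2
    calc (123648 * (ε * √L)) ^ 2 = (ε * 123648 ^ 2) * (√L ^ 2 * ε) := by ring
      _ ≤ 1 * 1 := by rw [hsq]; gcongr
      _ = 1 ^ 2 := by norm_num
  have hbound : ∀ N : ℕ, (∃ A : QueryAlgorithm N, A.Achieves (123648 ^ 2 * L) ε) →
      1 / 121856 * T ≤ N := by
    rintro N ⟨A, hA⟩
    -- This makes the bump height exactly `L`, so that its exponential is `1 / ε ≥ R`.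
    set w := √48 * √L with hw
    have h48 : √48 ≤ 7 := by rw [Real.sqrt_le_iff]; norm_num
    have h48' : 1 < √48 := by rw [Real.lt_sqrt] <;> norm_num
    have hsL1 : 1 ≤ √L := Real.one_le_sqrt.2 hL1.le
    have hw1 : 1 < w := by nlinarith
    have hw2 : w ^ 2 / 48 = L := by
      rw [hw, mul_pow, hsq, Real.sq_sqrt (by norm_num)]; ring
    set R := 1 / (128 * ε) with hR
    -- Here `896 = 128 * 7`, with `√48 ≤ 7`.
    have hRw : T / 896 ≤ R / w := by
      rw [hT, hR, hw, div_div, div_div]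
      refine one_div_le_one_div_of_le (by positivity) ?_
      calc 128 * ε * (√48 * √L) ≤ 128 * ε * (7 * √L) := by gcongr
        _ = _ := by ring
    have hn := hA.le_card hε (R := R) (w := w) (n := ⌊R / w⌋₊)
      (by rw [hR, le_div_iff₀ (by positivity)]; nlinarith) hw1
      (by rw [hR]; field_simp; rfl)
      (by rw [hw2, hexp, hR]; exact one_div_le_one_div_of_le hε (by linarith))
      (by rw [hw2]; nlinarith)
      (by
        have := Nat.floor_le (a := R / w) (by positivity)
        rwa [le_div_iff₀ (by linarith)] at this)
    have hfl := Nat.lt_floor_add_one (R / w)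
    linarith
  have hceil : ((⌈1 / 121856 * T⌉₊ : ℕ) : ℕ∞) ≤ warmStartComplexity (123648 ^ 2 * L) ε := by
    unfold warmStartComplexity
    exact le_iInf₂ fun N hN => Nat.cast_le.2 (Nat.ceil_le.2 (hbound N hN))
  calc ENNReal.ofReal (1 / 121856 * T)
      ≤ ((⌈1 / 121856 * T⌉₊ : ℕ) : ℝ≥0∞) := by
        rw [ENNReal.ofReal_le_iff_le_toReal (by finiteness), ENNReal.toReal_natCast]
        exact Nat.le_ceil _
    _ = (((⌈1 / 121856 * T⌉₊ : ℕ) : ℕ∞) : ℝ≥0∞) := by simp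
    _ ≤ _ := ENat.toENNReal_le.2 hceil
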